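/- For infinite cardinals $\lambda>\mu$ with $\mu$ regular, let $S^\lambda_\mu=\{\alpha<\lambda:\mathrm{cf}(\alpha)=\mu\}$. An $S^\lambda_\mu$-club sequence is a sequence $\underline C=\langle C_\alpha:\alpha\in S^\lambda_\mu\rangle$ such that each $C_\alpha\subseteq\alpha$ is closed and unbounded in $\alpha$ and has order type $\mu$; it is an $S^\lambda_\mu$-club guessing sequence if, moreover, for every club $E\subseteq\lambda$ there is $\alpha\in S^\lambda_\mu$ with $C_\alpha\subseteq E$. A MAD family on $\mu$ is a family $\mathcal M\subseteq[\mu]^\mu$ such that $|M\cap N|<\mu$ for all distinct $M,N\in\mathcal M$, and for every $A\in[\mu]^\mu$ there is $M\in\mathcal M$ with $|A\cap M|=\mu$. Given a MAD family $\mathcal M=\{M^\varphi:\varphi<\kappa\}$ on $\mu$, enumerated without repetition by a cardinal $\kappa$, and an $S^\lambda_\mu$-club sequence $\underline C$, the space $X=X[\lambda,\mu,\mathcal M,\underline C]$ is defined as follows. Let $X_\alpha=\{\alpha\}\times\kappa$ for $\alpha\in S^\lambda_\mu$, $X_\alpha=\{(\alpha,0)\}$ for $\alpha\in\lambda\setminus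 S^\lambda_\mu$, and $X=\bigcup_{\alpha<\lambda}X_\alpha$. For $\alpha\in S^\lambda_\mu$ let $\{a_\alpha^\xi:\xi<\mu\}$ be the increasing enumeration of $C_\alpha$, and let $I_\alpha^\xi=[a_\alpha^\xi,a_\alpha^{\xi+1}]$ if $\xi<\mu$ is a limit ordinal, $I_\alpha^\xi=(a_\alpha^\xi,a_\alpha^{\xi+1}]$ if $\xi<\mu$ is zero or a successor. The topology is given by the following neighbourhood bases. If $\mathrm{cf}(\alpha)=\mu$, a base at $(\alpha,\varphi)$ consists of the sets $\{(\alpha,\varphi)\}\cup\bigcup\{X_\gamma:\gamma\in I_\alpha^\xi,\ \xi\in M^\varphi\setminus\eta\}$ for $\eta<\mu$. If $\mathrm{cf}(\alpha)<\mu$ (including $\alpha=0$ and successors), $(\alpha,0)$ is isolated. If $\mathrm{cf}(\alpha)>\mu$, a base at $(\alpha,0)$ consists of the sets $\bigcup\{X_\gamma:\beta<\gamma\le\alpha\}$ for $\beta<\alpha$. For $F\subseteq X$ put $F_\alpha=F\cap X_\alpha$. Call $F$ unbounded if $\{\alpha<\lambda:F_\alpha\neq\emptyset\}$ is unbounded in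 $\lambda$, and high enough if $|\{\alpha<\lambda:|F_\alpha|=|F|\}|\ge\mu$. The space $X$ is high if every closed unbounded $F\subseteq X$ is high enough. **Corollary.** 1. Suppose $2^{\omega}\ge\omega_2$. Then there are a MAD family on $\omega$ of size $2^\omega$ and an $S^{\omega_2}_{\omega}$-club guessing sequence, and for every MAD family $\mathcal M$ on $\omega$ of size $2^\omega$ (enumerated without repetition by $2^\omega$) and every $S^{\omega_2}_{\omega}$-club guessing sequence $\underline C$, the space $X[\omega_2,\omega,\mathcal M,\underline C]$ is high. 2. Suppose $2^{\omega}=\omega_1$ and $2^{\omega_1}\ge\omega_3$. Then there are a MAD family on $\omega_1$ of size $2^{\omega_1}$ and an $S^{\omega_3}_{\omega_1}$-club guessing sequence, and for every MAD family $\mathcal M$ on $\omega_1$ of size $2^{\omega_1}$ (enumerated without repetition by $2^{\omega_1}$) and every $S^{\omega_3}_{\omega_1}$-club guessing sequence $\underline C$, the space $X[\omega_3,\omega_1,\mathcal M,\underline C]$ is high. -/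

import Mathlib

open Set Cardinal Ordinal

universe u

/-- `S^lam_mu`: the ordinals below the cardinal `lam` of cofinality `mu`. -/
def cofSet (lam mu : Cardinal.{u}) : Set Ordinal.{u} :=
  {α | α < lam.ord ∧ α.cof = mu}

/-- `E ⊆ o`, and `E` is closed and unbounded in the ordinal `o`. -/
def IsClubIn (E : Set Ordinal.{u}) (o : Ordinal.{u}) : Prop :=
  E ⊆ Iio o ∧ IsClub ((↑) ⁻¹' E : Set (Iio o))

/-- `⟨C δ : δ ∈ S⟩` is an `S`-club sequence, where `S` is a set of ordinals of cofinality `mu`: each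
`C δ` is a club subset of `δ` of order type `mu`. Values of `C` outside `S` are irrelevant. -/
def IsClubSequence (mu : Cardinal.{u}) (S : Set Ordinal.{u})
    (C : Ordinal.{u} → Set Ordinal.{u}) : Prop :=
  ∀ δ ∈ S, IsClubIn (C δ) δ ∧ Nonempty (Iio mu.ord ≃o C δ)

/-- An `S^lam_mu`-club guessing sequence: an `S^lam_mu`-club sequence `C` such that every club
`E ⊆ lam` contains `C δ` for some `δ ∈ S^lam_mu`. -/
def IsClubGuessing (lam mu : Cardinal.{u}) (C : Ordinal.{u} → Set Ordinal.{u}) : Prop :=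
  IsClubSequence mu (cofSet lam mu) C ∧
    ∀ E : Set Ordinal.{u}, IsClubIn E lam.ord → ∃ δ ∈ cofSet lam mu, C δ ⊆ E

/-- `A ∈ [mu]^mu`: `A` is a subset of `mu` of cardinality `mu`. -/
def IsLargeSubset (mu : Cardinal.{u}) (A : Set Ordinal.{u}) : Prop :=
  A ⊆ Iio mu.ord ∧ #A = Cardinal.lift.{u + 1} mu

/-- `𝓜` is a maximal almost disjoint family on `mu`. -/
structure IsMADFamily (mu : Cardinal.{u}) (𝓜 : Set (Set Ordinal.{u})) : Prop where
  large : ∀ A ∈ 𝓜, IsLargeSubset mu A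
  almostDisjoint : ∀ A ∈ 𝓜, ∀ B ∈ 𝓜, A ≠ B → #(A ∩ B : Set Ordinal.{u}) < Cardinal.lift.{u + 1} mu
  maximal : ∀ A, IsLargeSubset mu A →
    ∃ B ∈ 𝓜, #(A ∩ B : Set Ordinal.{u}) = Cardinal.lift.{u + 1} mu

namespace ClubSpace

/-- The column `X_α`: `{α} × kap` if `α` has cofinality `mu`, and `{(α, 0)}` otherwise. -/
def column (mu kap : Cardinal.{u}) (α : Ordinal.{u}) : Set (Ordinal.{u} × Ordinal.{u}) :=
  {p | p.1 = α ∧ ((α.cof = mu ∧ p.2 < kap.ord) ∨ (α.cof ≠ mu ∧ p.2 = 0))}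

/-- The underlying set `X = ⋃_{α < lam} X_α`. -/
def carrier (lam mu kap : Cardinal.{u}) : Set (Ordinal.{u} × Ordinal.{u}) :=
  ⋃ α ∈ Iio lam.ord, column mu kap α

open Classical in
/-- The interval `I_α^ξ`, where `a_α^ξ` is the `ξ`-th element of `C α` (in increasing order):
`[a_α^ξ, a_α^{ξ+1}]` for limit `ξ`, and `(a_α^ξ, a_α^{ξ+1}]` for `ξ` zero or a successor. -/
noncomputable def interval (C : Ordinal.{u} → Set Ordinal.{u}) (α ξ : Ordinal.{u}) :
    Set Ordinal.{u} :=
  if Order.IsSuccLimit ξ then Icc (enumOrd (C α) ξ) (enumOrd (C α) (ξ + 1))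
  else Ioc (enumOrd (C α) ξ) (enumOrd (C α) (ξ + 1))

/-- The basic neighbourhood `U((α, φ), η)` of a point `(α, φ)` with `α` of cofinality `mu`. -/
def basicMu (mu kap : Cardinal.{u}) (M C : Ordinal.{u} → Set Ordinal.{u})
    (x : Ordinal.{u} × Ordinal.{u}) (η : Ordinal.{u}) : Set (Ordinal.{u} × Ordinal.{u}) :=
  {x} ∪ ⋃ ξ ∈ M x.2 \ Iio η, ⋃ γ ∈ interval C x.1 ξ, column mu kap γ

/-- The prescribed neighbourhood base at the point `x = (α, φ)`. The three cases are
`cof α = mu`; `cof α < mu` (which includes `α = 0` and successors: `x` is isolated);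
and `cof α > mu`. -/
def base (mu kap : Cardinal.{u}) (M C : Ordinal.{u} → Set Ordinal.{u})
    (x : Ordinal.{u} × Ordinal.{u}) : Set (Set (Ordinal.{u} × Ordinal.{u})) :=
  {B | (x.1.cof = mu ∧ ∃ η < mu.ord, B = basicMu mu kap M C x η) ∨
    (x.1.cof < mu ∧ B = {x}) ∨
    (mu < x.1.cof ∧ ∃ β < x.1, B = ⋃ γ ∈ Ioc β x.1, column mu kap γ)}

/-- The set of points of `X[lam, mu, 𝓜, C]`, where `M` enumerates `𝓜` as `{M φ : φ < kap}`. -/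
@[ext]
structure Space (lam mu kap : Cardinal.{u}) (M C : Ordinal.{u} → Set Ordinal.{u}) :
    Type (u + 1) where
  val : Ordinal.{u} × Ordinal.{u}
  mem : val ∈ carrier lam mu kap

variable {lam mu kap : Cardinal.{u}} {M C : Ordinal.{u} → Set Ordinal.{u}}

/-- The topology given by the neighbourhood bases: `V` is open iff it is a neighbourhood of each
of its points, i.e. belongs to the filter generated by `base` at each of its points. -/
instance : TopologicalSpace (Space lam mu kap M C) :=
  TopologicalSpace.mkOfNhds fun x =>
    ⨅ B ∈ base mu kap M C x.val, Filter.principal {y : Space lam mu kap M C | y.val ∈ B}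

/-- `F_α = F ∩ X_α`. -/
def slice (F : Set (Space lam mu kap M C)) (α : Ordinal.{u}) : Set (Space lam mu kap M C) :=
  {x ∈ F | x.val ∈ column mu kap α}

/-- `F` is unbounded: `π(F) = {α < lam : F_α ≠ ∅}` is unbounded in `lam`. -/
def IsUnbounded (F : Set (Space lam mu kap M C)) : Prop :=
  ∀ β < lam.ord, ∃ α < lam.ord, β ≤ α ∧ (slice F α).Nonempty

/-- `F` is high enough: `|{α < lam : |F_α| = |F|}| ≥ mu`. -/
def IsHighEnough (F : Set (Space lam mu kap M C)) : Prop :=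
  Cardinal.lift.{u + 1} mu ≤ #{α : Ordinal.{u} | α < lam.ord ∧ #(slice F α) = #F}

/-- `F` is high: every closed unbounded subset of `F` is high enough. -/
def IsHigh (F : Set (Space lam mu kap M C)) : Prop :=
  ∀ G ⊆ F, IsClosed G → IsUnbounded G → IsHighEnough G

end ClubSpace

/-! Let `F` be closed and unbounded. The limit points of `π(F)` above a given `β` form a club in
`lam`, so some `C α` consists of such points. Each `a_α^{ξ+1}` is then a limit of levels met by `F`,
so `F` meets every interval `I_α^ξ`, hence every basic neighbourhood of every `(α, φ)`. Being
closed, `F` contains the whole column `X_α`, of size `kap`, which bounds the size of the space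
because `lam ≤ kap`; thus `|F_α| = |F|`. As `β` was arbitrary, such `α` are unbounded in the regular
`lam`, so there are at least `lam > mu` of them (`isHigh_univ`).

Club guessing sequences exist by Shelah's argument, which needs `mu⁺ < lam`: if every attempt
failed, a decreasing `mu⁺`-chain of clubs, each defeating the attempt made from an earlier one,
would stabilise on `mu` many points and contradict itself (`exists_isClubGuessing`). A large MAD
family extends the family of branches of the binary tree of height `mu`, which has at most `mu`
nodes when `2^c ≤ mu` for all `c < mu` (`exists_isMADFamily`). -/

/-! ### Clubs, closures and their order types -/

theorem isClubIn_iff {E : Set Ordinal.{u}} {o : Ordinal.{u}} :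
    IsClubIn E o ↔ E ⊆ Iio o ∧
      (∀ t ⊆ E, t.Nonempty → ∀ a < o, IsLUB t a → a ∈ E) ∧ ∀ β < o, ∃ x ∈ E, β ≤ x := by
  constructor
  · rintro ⟨hE, hc⟩
    refine ⟨hE, fun t ht ⟨y, hy⟩ a ha hta ↦ ?_, fun β hβ ↦ ?_⟩
    · refine hc.isLUB_mem (t := {x : Iio o | x.1 ∈ t}) (x := ⟨a, ha⟩) (fun x hx ↦ ht hx)
        ⟨⟨y, hE (ht hy)⟩, hy⟩ ⟨fun x hx ↦ hta.1 hx, fun b hb ↦ ?_⟩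
      exact hta.2 fun x hx ↦ hb (show (⟨x, hE (ht hx)⟩ : Iio o) ∈ {x : Iio o | x.1 ∈ t} from hx)
    · obtain ⟨x, hx, hx'⟩ := hc.isCofinal ⟨β, hβ⟩
      exact ⟨x, hx, hx'⟩
  · rintro ⟨hE, hc, hu⟩
    refine ⟨hE, ⟨fun t ht ht0 _ a ha ↦ ?_, fun β ↦ ?_⟩⟩
    · refine hc ((↑) '' t) (by rintro _ ⟨x, hx, rfl⟩; exact ht hx) (ht0.image _) a a.2
        ⟨by rintro _ ⟨x, hx, rfl⟩; exact ha.1 hx, fun b hb ↦ ?_⟩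
      by_cases hbo : b < o
      · exact ha.2 (show (⟨b, hbo⟩ : Iio o) ∈ upperBounds t from
          fun x hx ↦ hb (mem_image_of_mem _ hx))
      · exact a.2.le.trans (not_lt.1 hbo)
    · obtain ⟨x, hx, hx'⟩ := hu β β.2
      exact ⟨⟨x, hE hx⟩, hx, hx'⟩

theorem lift_cof_le_mk_of_unbounded {G : Set Ordinal.{u}} {α : Ordinal.{u}} (hG : G ⊆ Iio α)
    (hu : ∀ β < α, ∃ x ∈ G, β ≤ x) : Cardinal.lift.{u + 1} α.cof ≤ #G := by
  by_contra! h
  rw [Ordinal.lift_cof] at h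
  obtain ⟨x, hx, hle⟩ := hu _ (sSup_add_one_lt_of_lt_cof h hG)
  have hb : BddAbove ((· + 1) '' G) := by
    refine ⟨α, ?_⟩
    rintro _ ⟨y, hy, rfl⟩
    exact Order.add_one_le_of_lt (hG hy)
  have := (le_csSup hb (mem_image_of_mem _ hx)).trans hle
  exact (lt_add_one x).not_ge this

/-- In a longer order, the element at position `mu.ord` would have `mu` predecessors; a shorter one
is excluded by cardinality. -/
theorem nonempty_orderIso_of_initialSegments {G : Set Ordinal.{u}} {mu : Cardinal.{u}}
    (hseg : ∀ g ∈ G, #(G ∩ Iio g : Set Ordinal.{u}) < Cardinal.lift.{u + 1} mu)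
    (hG : Cardinal.lift.{u + 1} mu ≤ #G) : Nonempty (Iio mu.ord ≃o G) := by
  have hI : typeLT (Iio mu.ord) = (Cardinal.lift.{u + 1} mu).ord := by
    rw [← lift_ord, ← typein_ordinal]; rfl
  have hT : typeLT G = (Cardinal.lift.{u + 1} mu).ord := by
    apply le_antisymm
    · by_contra! h
      set x := Ordinal.enum (α := G) (· < ·) ⟨_, h⟩
      have hx : typein (α := G) (· < ·) x = _ := typein_enum _ h
      have hc := congrArg Ordinal.card hx
      rw [card_typein, card_ord] at hc
      refine (hseg x x.2).ne (hc ▸ ?_)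
      refine mk_congr ⟨fun y ↦ ⟨⟨y.1, y.2.1⟩, y.2.2⟩, fun y ↦ ⟨y.1.1, y.1.2, y.2⟩, ?_, ?_⟩ <;>
        intro y <;> rfl
    · rw [Cardinal.ord_le]
      exact hG
  obtain ⟨e⟩ := Ordinal.type_eq.1 (hI.trans hT.symm)
  exact ⟨OrderIso.ofRelIsoLT e⟩

/-- The limits below `α` of nonempty subsets of `G`. -/
def limitClosure (G : Set Ordinal.{u}) (α : Ordinal.{u}) : Set Ordinal.{u} :=
  {x | x < α ∧ ∃ t ⊆ G, t.Nonempty ∧ IsLUB t x}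

theorem limitClosure_subset {G D : Set Ordinal.{u}} {α o : Ordinal.{u}} (hα : α ≤ o)
    (hD : IsClubIn D o) (hG : G ⊆ D) : limitClosure G α ⊆ D := by
  rintro x ⟨hx, t, ht, ht0, hlub⟩
  exact (isClubIn_iff.1 hD).2.1 t (ht.trans hG) ht0 x (hx.trans_le hα) hlub

theorem isClubIn_limitClosure {G : Set Ordinal.{u}} {α : Ordinal.{u}} (hG : G ⊆ Iio α)
    (hu : ∀ β < α, ∃ x ∈ G, β < x) : IsClubIn (limitClosure G α) α := by
  refine isClubIn_iff.2 ⟨fun x hx ↦ hx.1, fun t ht ⟨y, hy⟩ a ha hta ↦ ⟨ha, ?_⟩, fun β hβ ↦ ?_⟩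
  · choose! s hs hs0 hlub using fun x (hx : x ∈ t) ↦ (ht hx).2
    refine ⟨⋃ x ∈ t, s x, iUnion₂_subset hs, ?_, ?_, fun b hb ↦ hta.2 fun x hx ↦ ?_⟩
    · obtain ⟨z, hz⟩ := hs0 y hy
      exact ⟨z, mem_biUnion hy hz⟩
    · intro z hz
      obtain ⟨x, hx, hz⟩ := mem_iUnion₂.1 hz
      exact ((hlub x hx).1 hz).trans (hta.1 hx)
    · exact (hlub x hx).2 fun z hz ↦ hb (mem_biUnion hx hz)
  · obtain ⟨x, hx, hβx⟩ := hu β hβ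
    exact ⟨x, ⟨hG hx, {x}, by simpa, singleton_nonempty x, isLUB_singleton⟩, hβx.le⟩

/-- Adding limits does not lengthen `G`: sending `x` to the next element of `G` above it is strictly
increasing on the closure, so initial segments of the closure inject into initial segments of `G`.
-/
theorem nonempty_orderIso_limitClosure {G : Set Ordinal.{u}} {α : Ordinal.{u}}
    (hG : G ⊆ Iio α) (hu : ∀ β < α, ∃ x ∈ G, β < x)
    (hseg : ∀ g ∈ G, #(G ∩ Iio g : Set Ordinal.{u}) < Cardinal.lift.{u + 1} α.cof) :
    Nonempty (Iio α.cof.ord ≃o limitClosure G α) := by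
  have hclub := isClubIn_iff.1 (isClubIn_limitClosure hG hu)
  refine nonempty_orderIso_of_initialSegments (fun k hk ↦ ?_)
    (lift_cof_le_mk_of_unbounded hclub.1 hclub.2.2)
  obtain ⟨g, hg, hkg⟩ := hu k hk.1
  have hne : ∀ x < α, (G ∩ Ioi x).Nonempty := fun x hx ↦ hu x hx
  have hlt : ∀ x ∈ limitClosure G α, ∀ y, y < x → sInf (G ∩ Ioi y) ≤ x := by
    intro x hx y hy
    obtain ⟨hx, t, ht, ht0, hlub⟩ := hx
    obtain ⟨z, hz, hyz⟩ := (lt_isLUB_iff hlub).1 hy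
    exact (csInf_le' (s := G ∩ Ioi y) ⟨ht hz, hyz⟩).trans (hlub.1 hz)
  have hmem : ∀ x < α, x < sInf (G ∩ Ioi x) := fun x hx ↦ (csInf_mem (hne x hx)).2
  have hmono : StrictMonoOn (fun y ↦ sInf (G ∩ Ioi y)) (limitClosure G α) :=
    fun x _ y hy hxy ↦ (hlt y hy x hxy).trans_lt (hmem y hy.1)
  refine (mk_le_of_injective (f := fun x : (limitClosure G α ∩ Iio k : Set Ordinal) ↦
    (⟨sInf (G ∩ Ioi x.1), (csInf_mem (hne x x.2.1.1)).1,
      (hlt k hk x x.2.2).trans_lt hkg⟩ : (G ∩ Iio g : Set Ordinal))) ?_).trans_lt (hseg g hg)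
  intro x y hxy
  exact Subtype.ext (hmono.injOn x.2.1 y.2.1 (congrArg Subtype.val hxy))

theorem exists_unbounded_of_cof {α : Ordinal.{u}} (hα : Order.IsSuccLimit α) :
    ∃ G ⊆ Iio α, (∀ β < α, ∃ x ∈ G, β < x) ∧ #G ≤ Cardinal.lift.{u + 1} α.cof ∧
      ∀ g ∈ G, #(G ∩ Iio g : Set Ordinal.{u}) < Cardinal.lift.{u + 1} α.cof := by
  obtain ⟨f, hf⟩ := exists_isFundamentalSeq (rfl : α.cof.ord = _)
  refine ⟨range fun i ↦ (f i).1, ?_, fun β hβ ↦ ?_, ?_, ?_⟩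
  · rintro _ ⟨i, rfl⟩; exact (f i).2
  · obtain ⟨_, ⟨i, rfl⟩, hi⟩ := hf.isCofinal_range ⟨β + 1, hα.add_one_lt hβ⟩
    exact ⟨_, ⟨i, rfl⟩, (lt_add_one β).trans_le hi⟩
  · exact mk_range_le.trans (by simp)
  · rintro _ ⟨i, rfl⟩
    have : (range (fun i ↦ (f i).1) ∩ Iio (f i).1) ⊆ range fun j : Iio i.1 ↦
        (f ⟨j.1, (show j.1 < i.1 from j.2).trans i.2⟩).1 := by
      rintro _ ⟨⟨j, rfl⟩, hj⟩
      exact ⟨⟨j.1, hf.strictMono.lt_iff_lt.1 hj⟩, rfl⟩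
    refine ((mk_le_mk_of_subset this).trans mk_range_le).trans_lt ?_
    rw [Cardinal.mk_Iio_ordinal, Cardinal.lift_lt, ← lt_ord]
    exact i.2

theorem isClubIn_iInter {ι : Type (u + 1)} {f : ι → Set Ordinal.{u}} {lam : Cardinal.{u}}
    (hlam : lam.IsRegular) (hω : ℵ₀ < lam) (hι : #ι < Cardinal.lift.{u + 1} lam)
    (hf : ∀ i, IsClubIn (f i) lam.ord) : IsClubIn (Iio lam.ord ∩ ⋂ i, f i) lam.ord := by
  refine ⟨inter_subset_left, ?_⟩
  have hcof : Order.cof (Iio lam.ord) = Cardinal.lift.{u + 1} lam := by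
    rw [cof_Iio, ← Ordinal.lift_cof, hlam.cof_ord]
  have := IsClub.iInter (α := Iio lam.ord) (f := fun i ↦ (↑) ⁻¹' f i)
    (by rw [hcof]; exact (by simpa using hω : ℵ₀ < Cardinal.lift.{u + 1} lam).ne')
    (by simpa [hcof] using hι) (fun i ↦ (hf i).2)
  convert this using 1
  ext x
  simp

/-- The element of `E` at position `mu.ord` works, since the enumeration of a club is normal and
normal functions preserve cofinality at limits. -/
theorem exists_cofSet_limit {E : Set Ordinal.{u}} {lam mu : Cardinal.{u}} (hlam : lam.IsRegular)
    (hmu : mu.IsRegular) (hlt : mu < lam) (hE : IsClubIn E lam.ord) :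
    ∃ α ∈ cofSet lam mu, ∀ β < α, ∃ x ∈ E, β < x ∧ x < α := by
  obtain ⟨hEs, hEc, hEu⟩ := isClubIn_iff.1 hE
  -- The added tail makes the set unbounded, so that `enumOrd` is normal on all ordinals; below
  -- `lam` it still enumerates `E`.
  set s := E ∪ Ici lam.ord
  have hs : ¬ BddAbove s := fun h ↦ not_bddAbove_Ici (a := lam.ord) (h.mono subset_union_right)
  have hnorm : Order.IsNormal (enumOrd s) := by
    refine isNormal_enumOrd (fun t ht ht0 htb ↦ ?_) hs
    by_cases h : sSup t < lam.ord
    · refine .inl (hEc t (fun x hx ↦ ?_) ht0 _ h (isLUB_csSup ht0 htb))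
      exact (ht hx).resolve_right fun hx' ↦ (h.trans_le hx').not_ge (le_csSup htb hx)
    · exact .inr (not_lt.1 h)
  have hbd : ∀ ξ < lam.ord, enumOrd s ξ < lam.ord := by
    intro ξ hξ
    by_contra! h
    have hsub : E ⊆ enumOrd s '' Iio ξ := by
      intro x hx
      obtain ⟨ζ, rfl⟩ := enumOrd_surjective hs (b := x) (.inl hx)
      exact ⟨ζ, (enumOrd_lt_enumOrd hs).1 ((hEs hx).trans_le h), rfl⟩
    have h1 := lift_cof_le_mk_of_unbounded hEs hEu
    have h2 := h1.trans ((mk_le_mk_of_subset hsub).trans mk_image_le)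
    rw [hlam.cof_ord, Cardinal.mk_Iio_ordinal, Cardinal.lift_le] at h2
    exact (Cardinal.lt_ord.1 hξ).not_ge h2
  have hlim : Order.IsSuccLimit mu.ord := isSuccLimit_ord hmu.aleph0_le
  have hmul : mu.ord < lam.ord := ord_lt_ord.2 hlt
  refine ⟨enumOrd s mu.ord, ⟨hbd _ hmul, ?_⟩, fun β hβ ↦ ?_⟩
  · rw [cof_map_of_isNormal hnorm hlim, hmu.cof_ord]
  · obtain ⟨i, hi, hβi⟩ := (hnorm.lt_iff_exists_lt hlim).1 hβ
    exact ⟨_, (enumOrd_mem hs i).resolve_right (hbd i (hi.trans hmul)).not_ge, hβi,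
      hnorm.strictMono hi⟩

/-! ### Shelah's club guessing -/

/-- The result of moving each element of `H` down to `E`. -/
def glueDown (H E : Set Ordinal.{u}) : Set Ordinal.{u} :=
  (fun γ ↦ sSup (E ∩ Iic γ)) '' H \ {0}

theorem bddAbove_inter_Iic (E : Set Ordinal.{u}) (γ : Ordinal.{u}) : BddAbove (E ∩ Iic γ) :=
  ⟨γ, fun _ hx ↦ hx.2⟩

theorem monotone_sSup_inter_Iic (E : Set Ordinal.{u}) : Monotone fun γ ↦ sSup (E ∩ Iic γ) :=
  fun _ b hab ↦ csSup_le_csSup' (bddAbove_inter_Iic E b)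
    (inter_subset_inter_right _ (Iic_subset_Iic.2 hab))

theorem sSup_inter_Iic_le (E : Set Ordinal.{u}) (γ : Ordinal.{u}) : sSup (E ∩ Iic γ) ≤ γ :=
  csSup_le' fun _ hx ↦ hx.2

section glueDown
variable {H E : Set Ordinal.{u}} {α : Ordinal.{u}}

theorem glueDown_subset (hH : H ⊆ Iio α) : glueDown H E ⊆ Iio α := by
  rintro _ ⟨⟨γ, hγ, rfl⟩, -⟩
  exact (sSup_inter_Iic_le E γ).trans_lt (hH hγ)

theorem glueDown_unbounded (hH : ∀ β < α, ∃ x ∈ H, β < x)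
    (hE : ∀ β < α, ∃ x ∈ E, β < x ∧ x < α) : ∀ β < α, ∃ x ∈ glueDown H E, β < x := by
  intro β hβ
  obtain ⟨e, he, hβe, heα⟩ := hE β hβ
  obtain ⟨γ, hγ, heγ⟩ := hH e heα
  have h : β < sSup (E ∩ Iic γ) :=
    hβe.trans_le (le_csSup (bddAbove_inter_Iic E γ) ⟨he, heγ.le⟩)
  exact ⟨_, ⟨⟨γ, hγ, rfl⟩, (h.bot_lt).ne'⟩, h⟩

theorem mk_glueDown_inter_Iio_lt {c : Cardinal.{u + 1}}
    (hH : ∀ g ∈ H, #(H ∩ Iio g : Set Ordinal.{u}) < c) :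
    ∀ g ∈ glueDown H E, #(glueDown H E ∩ Iio g : Set Ordinal.{u}) < c := by
  rintro _ ⟨⟨γ, hγ, rfl⟩, -⟩
  have hsub : glueDown H E ∩ Iio (sSup (E ∩ Iic γ)) ⊆
      (fun γ ↦ sSup (E ∩ Iic γ)) '' (H ∩ Iio γ) := by
    rintro _ ⟨⟨⟨δ, hδ, rfl⟩, -⟩, hlt⟩
    exact ⟨δ, ⟨hδ, (monotone_sSup_inter_Iic E).reflect_lt hlt⟩, rfl⟩
  exact ((mk_le_mk_of_subset hsub).trans mk_image_le).trans_lt (hH γ hγ)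

end glueDown

/-- Intersecting the values of `D` along a transfinite iteration. -/
def iteratedInter (D : Set Ordinal.{u} → Set Ordinal.{u}) (o ξ : Ordinal.{u}) : Set Ordinal.{u} :=
  Iio o ∩ ⋂ ζ : Iio ξ, D (iteratedInter D o ζ.1)
termination_by ξ
decreasing_by exact ζ.2

theorem iteratedInter_antitone (D : Set Ordinal.{u} → Set Ordinal.{u}) (o : Ordinal.{u}) :
    Antitone (iteratedInter D o) := by
  intro ξ η h x hx
  rw [iteratedInter] at hx ⊢
  exact ⟨hx.1, mem_iInter.2 fun ζ ↦ mem_iInter.1 hx.2 ⟨ζ.1, ζ.2.trans_le h⟩⟩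

theorem iteratedInter_add_one_subset (D : Set Ordinal.{u} → Set Ordinal.{u}) (o ξ : Ordinal.{u}) :
    iteratedInter D o (ξ + 1) ⊆ D (iteratedInter D o ξ) := by
  intro x hx
  rw [iteratedInter] at hx
  exact mem_iInter.1 hx.2 ⟨ξ, lt_add_one ξ⟩

theorem isClubIn_iteratedInter {D : Set Ordinal.{u} → Set Ordinal.{u}} {lam : Cardinal.{u}}
    (hlam : lam.IsRegular) (hω : ℵ₀ < lam) (hD : ∀ E, IsClubIn (D E) lam.ord) {ξ : Ordinal.{u}}
    (hξ : ξ < lam.ord) : IsClubIn (iteratedInter D lam.ord ξ) lam.ord := by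
  rw [iteratedInter]
  refine isClubIn_iInter hlam hω ?_ fun _ ↦ hD _
  rw [Cardinal.mk_Iio_ordinal, Cardinal.lift_lt]
  exact Cardinal.lt_ord.1 hξ

/-- For fixed `γ`, the value `sup (E ξ ∩ [0, γ])` does not increase with `ξ`, hence is eventually
constant. At most `mu` many `γ` are involved, so by regularity of `mu⁺` one stage `ξ` is past all
stabilisation points. A value unchanged from `ξ` to `ξ + 1` lies in the closed set `E (ξ + 1)`. -/
theorem exists_glueDown_subset_add_one {α : Ordinal.{u}} {H : Set Ordinal.{u}} {mu : Cardinal.{u}}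
    (hmu : ℵ₀ ≤ mu) (hH : #H ≤ Cardinal.lift.{u + 1} mu) {lam : Cardinal.{u}}
    {E : Ordinal.{u} → Set Ordinal.{u}} (hE : Antitone E)
    (hclub : ∀ ξ < (Order.succ mu).ord, IsClubIn (E ξ) lam.ord) (hα : α < lam.ord)
    (hHα : H ⊆ Iio α) :
    ∃ ξ < (Order.succ mu).ord, glueDown H (E ξ) ⊆ E (ξ + 1) := by
  set o := (Order.succ mu).ord
  have hreg : (Order.succ mu).IsRegular := isRegular_succ hmu
  have hlim : Order.IsSuccLimit o := isSuccLimit_ord hreg.aleph0_le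
  have hstab : ∀ γ, ∃ ξ < o, ∀ η < o, sSup (E ξ ∩ Iic γ) ≤ sSup (E η ∩ Iic γ) := by
    intro γ
    obtain ⟨_, ⟨ξ, hξ, rfl⟩, hmin⟩ := WellFounded.has_min (wellFounded_lt (α := Ordinal.{u}))
      ((fun ξ ↦ sSup (E ξ ∩ Iic γ)) '' Iio o) ⟨_, 0, hlim.bot_lt, rfl⟩
    exact ⟨ξ, hξ, fun η hη ↦ not_lt.1 (hmin _ ⟨η, hη, rfl⟩)⟩
  choose g hgo hg using hstab
  have hsup : sSup (g '' H) < o := by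
    refine sSup_lt_of_lt_cof ?_ (by rintro _ ⟨γ, -, rfl⟩; exact hgo γ)
    rw [← Ordinal.lift_cof, hreg.cof_ord]
    exact (mk_image_le.trans hH).trans_lt (Cardinal.lift_lt.2 (Order.lt_succ mu))
  have hbdd : BddAbove (g '' H) := ⟨o, by rintro _ ⟨γ, -, rfl⟩; exact (hgo γ).le⟩
  set ξ := sSup (g '' H)
  refine ⟨ξ, hsup, ?_⟩
  rintro _ ⟨⟨γ, hγ, rfl⟩, hne⟩
  have hanti : ∀ {a b}, a ≤ b → sSup (E b ∩ Iic γ) ≤ sSup (E a ∩ Iic γ) := fun h ↦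
    csSup_le_csSup' (bddAbove_inter_Iic _ γ) (inter_subset_inter_left _ (hE h))
  have heq : sSup (E ξ ∩ Iic γ) = sSup (E (ξ + 1) ∩ Iic γ) :=
    ((hanti (le_csSup hbdd (mem_image_of_mem g hγ))).trans
      (hg γ _ (hlim.add_one_lt hsup))).antisymm (hanti (le_self_add))
  simp only [mem_singleton_iff] at hne
  beta_reduce
  rw [heq] at hne ⊢
  -- The supremum of the empty set is `0`, and `glueDown` discards `0`.
  have hnonempty : (E (ξ + 1) ∩ Iic γ).Nonempty := by
    by_contra! h
    simp [h] at hne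
  exact (isClubIn_iff.1 (hclub _ (hlim.add_one_lt hsup))).2.1 _ inter_subset_left hnonempty _
    ((sSup_inter_Iic_le _ γ).trans_lt ((hHα hγ).trans hα))
    (isLUB_csSup hnonempty (bddAbove_inter_Iic _ γ))

/-- Shelah's club guessing theorem: if `mu` and `lam` are regular and `mu⁺ < lam`, then there is an
`S^lam_mu`-club guessing sequence. -/
theorem exists_isClubGuessing {lam mu : Cardinal.{u}} (hlam : lam.IsRegular) (hmu : mu.IsRegular)
    (hlt : Order.succ mu < lam) : ∃ C : Ordinal.{u} → Set Ordinal.{u}, IsClubGuessing lam mu C := by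
  classical
  by_contra! hno
  have hlimit : ∀ α ∈ cofSet lam mu, Order.IsSuccLimit α := fun α hα ↦
    aleph0_le_cof_iff.1 (hα.2 ▸ hmu.aleph0_le) |> one_lt_cof_iff.1
  choose! H hHsub hHunb hHcard hHseg using fun α (hα : α ∈ cofSet lam mu) ↦
    exists_unbounded_of_cof (hlimit α hα)
  have hfail : ∀ E : Set Ordinal.{u}, ∃ D, IsClubIn D lam.ord ∧ ∀ α ∈ cofSet lam mu,
      (∀ β < α, ∃ x ∈ E, β < x ∧ x < α) → ¬ glueDown (H α) E ⊆ D := by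
    intro E
    -- Gluing down yields a cofinal set only where `E` is cofinal in `α`; elsewhere `H α` is kept,
    -- so that every entry is cofinal.
    set G : Ordinal.{u} → Set Ordinal.{u} := fun α ↦
      if ∀ β < α, ∃ x ∈ E, β < x ∧ x < α then glueDown (H α) E else H α with hGdef
    have hseq : IsClubSequence mu (cofSet lam mu) fun α ↦ limitClosure (G α) α := by
      intro α hα
      have hG : G α ⊆ Iio α ∧ (∀ β < α, ∃ x ∈ G α, β < x) ∧
          ∀ g ∈ G α, #(G α ∩ Iio g : Set Ordinal.{u}) < Cardinal.lift.{u + 1} α.cof := by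
        by_cases h : ∀ β < α, ∃ x ∈ E, β < x ∧ x < α
        · simp only [hGdef, if_pos h]
          exact ⟨glueDown_subset (hHsub α hα), glueDown_unbounded (hHunb α hα) h,
            mk_glueDown_inter_Iio_lt (hHseg α hα)⟩
        · simp only [hGdef, if_neg h]
          exact ⟨hHsub α hα, hHunb α hα, hHseg α hα⟩
      refine ⟨isClubIn_limitClosure hG.1 hG.2.1, ?_⟩
      have := nonempty_orderIso_limitClosure hG.1 hG.2.1 hG.2.2
      rwa [hα.2] at this
    have := hno fun α ↦ limitClosure (G α) α
    simp only [IsClubGuessing, hseq, true_and, not_forall, not_exists, not_and] at this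
    obtain ⟨D, hD, hDG⟩ := this
    refine ⟨D, hD, fun α hα hlim hsub ↦ hDG α hα (limitClosure_subset hα.1.le hD ?_)⟩
    simpa only [hGdef, if_pos hlim] using hsub
  choose D hD hDfail using hfail
  have hω : ℵ₀ < lam := hmu.aleph0_le.trans_lt ((Order.lt_succ mu).trans hlt)
  have hclub : ∀ ξ < lam.ord, IsClubIn (iteratedInter D lam.ord ξ) lam.ord := fun ξ hξ ↦
    isClubIn_iteratedInter hlam hω hD hξ
  have hlto : (Order.succ mu).ord < lam.ord := ord_lt_ord.2 hlt
  -- A limit point of the last set of the chain is a limit point of every earlier one, so the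
  -- failure at each stage `ξ` applies to this `α`.
  obtain ⟨α, hα, hαlim⟩ := exists_cofSet_limit hlam hmu ((Order.lt_succ mu).trans hlt)
    (hclub _ hlto)
  obtain ⟨ξ, hξ, hsub⟩ := exists_glueDown_subset_add_one hmu.aleph0_le (hα.2 ▸ hHcard α hα)
    (iteratedInter_antitone D lam.ord) (fun ξ hξ ↦ hclub ξ (hξ.trans hlto)) hα.1 (hHsub α hα)
  refine hDfail (iteratedInter D lam.ord ξ) α hα (fun β hβ ↦ ?_)
    (hsub.trans (iteratedInter_add_one_subset D lam.ord ξ))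
  obtain ⟨x, hx, h⟩ := hαlim β hβ
  exact ⟨x, iteratedInter_antitone D lam.ord hξ.le hx, h⟩

/-! ### Large MAD families -/

/-- The branch of the binary tree of height `mu` determined by `A ⊆ mu`. -/
def branch (mu : Cardinal.{u}) (A : Set Ordinal.{u}) : Set (Ordinal.{u} × Set Ordinal.{u}) :=
  (fun γ ↦ (γ, A ∩ Iio γ)) '' Iio mu.ord

theorem mk_branch (mu : Cardinal.{u}) (A : Set Ordinal.{u}) :
    #(branch mu A) = Cardinal.lift.{u + 1} mu := by
  rw [branch, mk_image_eq fun a b h ↦ (Prod.ext_iff.1 h).1]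
  simp

/-- If `A` and `B` differ at `δ`, their branches share no node at a level above `δ`. -/
theorem mk_branch_inter_lt {mu : Cardinal.{u}} (hmu : ℵ₀ ≤ mu) {A B : Set Ordinal.{u}}
    (hA : A ⊆ Iio mu.ord) (hB : B ⊆ Iio mu.ord) (hAB : A ≠ B) :
    #(branch mu A ∩ branch mu B : Set _) < Cardinal.lift.{u + 1} mu := by
  obtain ⟨δ, hδ, hne⟩ : ∃ δ < mu.ord, ¬ (δ ∈ A ↔ δ ∈ B) := by
    by_contra! h
    exact hAB (Set.ext fun x ↦ ⟨fun hx ↦ (h x (hA hx)).1 hx, fun hx ↦ (h x (hB hx)).2 hx⟩)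
  have hsub : branch mu A ∩ branch mu B ⊆ (fun γ ↦ (γ, A ∩ Iio γ)) '' Iio (δ + 1) := by
    rintro _ ⟨⟨γ, -, rfl⟩, ⟨γ', -, h⟩⟩
    obtain ⟨rfl, h⟩ := Prod.ext_iff.1 h
    refine ⟨γ', mem_Iio.2 (Order.lt_add_one_iff.2 (not_lt.1 fun hlt ↦ hne ?_)), rfl⟩
    have := Set.ext_iff.1 h δ
    simp only [mem_inter_iff, mem_Iio, hlt, and_true] at this
    exact this.symm
  refine ((mk_le_mk_of_subset hsub).trans mk_image_le).trans_lt ?_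
  rw [Cardinal.mk_Iio_ordinal, Cardinal.lift_lt, ← Cardinal.lt_ord]
  exact (isSuccLimit_ord hmu).add_one_lt hδ

/-- The nodes of the binary tree of height `mu`. -/
def binaryTree (mu : Cardinal.{u}) : Set (Ordinal.{u} × Set Ordinal.{u}) :=
  ⋃ γ ∈ Iio mu.ord, Prod.mk γ '' 𝒫 (Iio γ)

theorem branch_subset_binaryTree (mu : Cardinal.{u}) (A : Set Ordinal.{u}) :
    branch mu A ⊆ binaryTree mu := by
  rintro _ ⟨γ, hγ, rfl⟩
  exact mem_biUnion hγ ⟨_, inter_subset_right, rfl⟩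

theorem mk_binaryTree_le {mu : Cardinal.{u}} (hmu : ℵ₀ ≤ mu)
    (hpow : ∀ c < mu, (2 : Cardinal.{u}) ^ c ≤ mu) :
    #(binaryTree mu) ≤ Cardinal.lift.{u + 1} mu := by
  refine (mk_biUnion_le _ _).trans ?_
  rw [Cardinal.mk_Iio_ordinal, card_ord]
  refine mul_le_of_le (by simpa using hmu) le_rfl (ciSup_le' fun γ ↦ ?_)
  refine mk_image_le.trans ?_
  rw [mk_powerset, Cardinal.mk_Iio_ordinal, ← Cardinal.lift_two.{u + 1, u}, ← Cardinal.lift_power,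
    Cardinal.lift_le]
  exact hpow _ (Cardinal.lt_ord.1 γ.2)

/-- `𝓐` is an almost disjoint family on `mu`. -/
def IsAlmostDisjointFamily (mu : Cardinal.{u}) (𝓐 : Set (Set Ordinal.{u})) : Prop :=
  (∀ A ∈ 𝓐, IsLargeSubset mu A) ∧
    𝓐.Pairwise fun A B ↦ #(A ∩ B : Set Ordinal.{u}) < Cardinal.lift.{u + 1} mu

/-- The branches are almost disjoint sets of nodes; an injection of the tree into `mu` carries them
to subsets of `mu`. -/
theorem exists_almostDisjointFamily {mu : Cardinal.{u}} (hmu : ℵ₀ ≤ mu)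
    (hpow : ∀ c < mu, (2 : Cardinal.{u}) ^ c ≤ mu) :
    ∃ 𝓐, IsAlmostDisjointFamily mu 𝓐 ∧ #𝓐 = Cardinal.lift.{u + 1} (2 ^ mu) := by
  obtain ⟨g⟩ : Nonempty (binaryTree mu ↪ Iio mu.ord) := by
    rw [← Cardinal.le_def]
    simpa using mk_binaryTree_le hmu hpow
  set f : Set Ordinal.{u} → Set Ordinal.{u} := fun A ↦
    (fun x ↦ (g x).1) '' {x : binaryTree mu | x.1 ∈ branch mu A}
  have hg : Function.Injective fun x ↦ (g x).1 := Subtype.val_injective.comp g.injective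
  have hcard : ∀ s ⊆ binaryTree mu,
      #((fun x ↦ (g x).1) '' {x : binaryTree mu | x.1 ∈ s}) = #s := by
    intro s hs
    rw [mk_image_eq hg]
    exact mk_congr ⟨fun x ↦ ⟨x.1.1, x.2⟩, fun x ↦ ⟨⟨x.1, hs x.2⟩, x.2⟩, fun _ ↦ rfl, fun _ ↦ rfl⟩
  have hf : ∀ A, #(f A) = Cardinal.lift.{u + 1} mu := fun A ↦
    (hcard _ (branch_subset_binaryTree mu A)).trans (mk_branch mu A)
  have hinter : ∀ A ⊆ Iio mu.ord, ∀ B ⊆ Iio mu.ord, A ≠ B →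
      #(f A ∩ f B : Set Ordinal.{u}) < Cardinal.lift.{u + 1} mu := by
    intro A hA B hB hAB
    have : f A ∩ f B = (fun x ↦ (g x).1) ''
        {x : binaryTree mu | x.1 ∈ branch mu A ∩ branch mu B} := (image_inter hg).symm
    rw [this, hcard _ (inter_subset_left.trans (branch_subset_binaryTree mu A))]
    exact mk_branch_inter_lt hmu hA hB hAB
  have hinj : InjOn f (𝒫 (Iio mu.ord)) := by
    intro A hA B hB h
    by_contra hne
    have := hinter A hA B hB hne
    rw [← h, inter_self, hf] at this
    exact this.false
  refine ⟨f '' 𝒫 (Iio mu.ord), ⟨?_, ?_⟩, ?_⟩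
  · rintro _ ⟨A, -, rfl⟩
    refine ⟨?_, hf A⟩
    rintro _ ⟨x, -, rfl⟩
    exact (g x).2
  · rintro _ ⟨A, hA, rfl⟩ _ ⟨B, hB, rfl⟩ hne
    exact hinter A hA B hB fun h ↦ hne (h ▸ rfl)
  · rw [mk_image_eq_of_injOn _ _ hinj, mk_powerset, Cardinal.mk_Iio_ordinal, card_ord,
      Cardinal.lift_power, Cardinal.lift_two]

/-- Zorn's lemma applies; a large set almost disjoint from every member of an inclusion-maximal
family could be inserted into it. -/
theorem exists_isMADFamily_superset {mu : Cardinal.{u}} {𝓐 : Set (Set Ordinal.{u})}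
    (h𝓐 : IsAlmostDisjointFamily mu 𝓐) : ∃ 𝓜, 𝓐 ⊆ 𝓜 ∧ IsMADFamily mu 𝓜 := by
  obtain ⟨𝓜, hsub, hmax⟩ := zorn_subset_nonempty {𝓑 | IsAlmostDisjointFamily mu 𝓑}
    (fun c hc hchain _ ↦ ⟨⋃₀ c, ⟨fun A ⟨𝓑, h𝓑, hA⟩ ↦ (hc h𝓑).1 A hA,
      (pairwise_sUnion hchain.directedOn).2 fun 𝓑 h𝓑 ↦ (hc h𝓑).2⟩,
      fun s hs ↦ subset_sUnion_of_mem hs⟩) 𝓐 h𝓐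
  refine ⟨𝓜, hsub, hmax.prop.1, fun A hA B hB h ↦ hmax.prop.2 hA hB h, fun A hA ↦ ?_⟩
  by_contra! hne
  have hlt : ∀ B ∈ 𝓜, #(A ∩ B : Set Ordinal.{u}) < Cardinal.lift.{u + 1} mu := fun B hB ↦
    lt_of_le_of_ne (hA.2 ▸ mk_le_mk_of_subset inter_subset_left) (hne B hB)
  have hins : IsAlmostDisjointFamily mu (insert A 𝓜) := by
    refine ⟨fun B hB ↦ ?_, hmax.prop.2.insert fun B hB _ ↦ ⟨hlt B hB, ?_⟩⟩
    · rcases hB with rfl | hB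
      exacts [hA, hmax.prop.1 B hB]
    · rw [inter_comm]
      exact hlt B hB
  have hmem : A ∈ 𝓜 := hmax.le_of_ge hins (subset_insert A 𝓜) (mem_insert A 𝓜)
  exact hne A hmem (by rw [inter_self, hA.2])

theorem exists_isMADFamily {mu : Cardinal.{u}} (hmu : ℵ₀ ≤ mu)
    (hpow : ∀ c < mu, (2 : Cardinal.{u}) ^ c ≤ mu) :
    ∃ 𝓜, IsMADFamily mu 𝓜 ∧ #𝓜 = Cardinal.lift.{u + 1} (2 ^ mu) := by
  obtain ⟨𝓐, h𝓐, hcard⟩ := exists_almostDisjointFamily hmu hpow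
  obtain ⟨𝓜, hsub, h𝓜⟩ := exists_isMADFamily_superset h𝓐
  refine ⟨𝓜, h𝓜, le_antisymm ?_ (hcard ▸ mk_le_mk_of_subset hsub)⟩
  refine (mk_le_mk_of_subset (t := 𝒫 (Iio mu.ord)) fun A hA ↦ (h𝓜.large A hA).1).trans ?_
  rw [mk_powerset, Cardinal.mk_Iio_ordinal, card_ord, Cardinal.lift_power, Cardinal.lift_two]

/-! ### Enumerations and limit points -/

/-- The sets `C α` are bounded, so `enumOrd` is meaningful only at positions below their order type;
there it agrees with the isomorphism. -/
theorem enumOrd_eq_orderIso {G : Set Ordinal.{u}} {o : Ordinal.{u}} (e : Iio o ≃o G)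
    (ξ : Iio o) : enumOrd G ξ = e ξ := by
  obtain ⟨ξ, hξ⟩ := ξ
  induction ξ using WellFoundedLT.induction with
  | ind ξ ih =>
    have hlt : ∀ b (hb : b < ξ), enumOrd G b < e ⟨ξ, hξ⟩ := fun b hb ↦ by
      rw [ih b hb (hb.trans hξ)]
      exact e.strictMono hb
    apply le_antisymm (enumOrd_le_of_forall_lt (e ⟨ξ, hξ⟩).2 hlt)
    rw [enumOrd]
    refine le_csInf ⟨_, (e ⟨ξ, hξ⟩).2, hlt⟩ ?_
    rintro x ⟨hx, hx'⟩
    obtain ⟨⟨ζ, hζ⟩, hζx⟩ := e.surjective ⟨x, hx⟩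
    obtain rfl : (e ⟨ζ, hζ⟩).1 = x := congrArg Subtype.val hζx
    refine e.monotone (show ξ ≤ ζ from not_lt.1 fun h ↦ ?_)
    have := hx' ζ h
    rw [ih ζ h hζ] at this
    exact this.false

/-- For unboundedness, step upwards through `P` countably often; the supremum is a limit of `P` and
stays below `lam` because `lam` is regular and uncountable. -/
theorem isClubIn_limitPoints {P : Set Ordinal.{u}} {lam : Cardinal.{u}} (hlam : lam.IsRegular)
    (hω : ℵ₀ < lam) (hP : P ⊆ Iio lam.ord) (hu : ∀ β < lam.ord, ∃ x ∈ P, β ≤ x)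
    {β₀ : Ordinal.{u}} (hβ₀ : β₀ < lam.ord) :
    IsClubIn {δ | δ < lam.ord ∧ β₀ ≤ δ ∧ ∀ β < δ, ∃ x ∈ P, β < x ∧ x < δ} lam.ord := by
  have hlim : Order.IsSuccLimit lam.ord := isSuccLimit_ord hlam.aleph0_le
  refine isClubIn_iff.2 ⟨fun x hx ↦ hx.1, fun t ht ⟨y, hy⟩ a ha hta ↦ ⟨ha, ?_, fun β hβ ↦ ?_⟩,
    fun β hβ ↦ ?_⟩
  · exact (ht hy).2.1.trans (hta.1 hy)
  · obtain ⟨z, hz, hβz⟩ := (lt_isLUB_iff hta).1 hβ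
    obtain ⟨x, hx, hβx, hxz⟩ := (ht hz).2.2 β hβz
    exact ⟨x, hx, hβx, hxz.trans_le (hta.1 hz)⟩
  · choose! f hfP hf using fun β (hβ : β < lam.ord) ↦ hu (β + 1) (hlim.add_one_lt hβ)
    have hfl : ∀ β < lam.ord, β < f β := fun β hβ ↦ (lt_add_one β).trans_le (hf β hβ)
    set b := max β₀ β
    have hit : ∀ n : ℕ, f^[n] b < lam.ord := by
      intro n
      induction n with
      | zero => exact max_lt hβ₀ hβ
      | succ n ih =>
        rw [Function.iterate_succ_apply']
        exact hP (hfP _ ih)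
    have hle : ∀ n : ℕ, f^[n] b ≤ ⨆ n : ℕ, f^[n] b := Ordinal.le_iSup fun n : ℕ ↦ f^[n] b
    have hb : b ≤ ⨆ n : ℕ, f^[n] b := hle 0
    refine ⟨⨆ n : ℕ, f^[n] b, ⟨?_, (le_max_left _ _).trans hb, fun γ hγ ↦ ?_⟩,
      (le_max_right _ _).trans hb⟩
    · refine lift_iSup_lt_of_lt_cof ?_ hit
      simpa [hlam.cof_ord] using hω
    · obtain ⟨n, hn⟩ := (Ordinal.lt_iSup_iff).1 hγ
      refine ⟨f^[n + 1] b, ?_, ?_, ?_⟩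
      · rw [Function.iterate_succ_apply']
        exact hfP _ (hit n)
      · rw [Function.iterate_succ_apply']
        exact hn.trans (hfl _ (hit n))
      · refine lt_of_lt_of_le ?_ (hle (n + 2))
        rw [Function.iterate_succ_apply' _ (n + 1)]
        exact hfl _ (hit (n + 1))

theorem IsLargeSubset.exists_ge {mu : Cardinal.{u}} {A : Set Ordinal.{u}} (hA : IsLargeSubset mu A)
    {η : Ordinal.{u}} (hη : η < mu.ord) : ∃ ξ ∈ A, η ≤ ξ := by
  by_contra! h
  have := mk_le_mk_of_subset (show A ⊆ Iio η from h)
  rw [hA.2, Cardinal.mk_Iio_ordinal, Cardinal.lift_le] at this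
  exact (Cardinal.lt_ord.1 hη).not_ge this

/-! ### Highness of the space -/

namespace ClubSpace

variable {lam mu kap : Cardinal.{u}} {M C : Ordinal.{u} → Set Ordinal.{u}}

theorem mk_space_le (hlam : ℵ₀ ≤ lam) (hle : lam ≤ kap) :
    #(Space lam mu kap M C) ≤ Cardinal.lift.{u + 1} kap := by
  have hmem : ∀ x : Space lam mu kap M C, x.val.1 < lam.ord ∧ x.val.2 < kap.ord := by
    intro x
    obtain ⟨α, hα, rfl, h⟩ := mem_iUnion₂.1 x.mem
    refine ⟨hα, h.elim (fun h ↦ h.2) fun h ↦ ?_⟩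
    rw [h.2]
    exact (isSuccLimit_ord (hlam.trans hle)).bot_lt
  have hinj : Function.Injective fun x : Space lam mu kap M C ↦
      ((⟨x.val.1, (hmem x).1⟩, ⟨x.val.2, (hmem x).2⟩) : Iio lam.ord × Iio kap.ord) := by
    intro x y h
    exact Space.ext (Prod.ext (congrArg (fun p ↦ p.1.1) h) (congrArg (fun p ↦ p.2.1) h))
  refine (mk_le_of_injective hinj).trans ?_
  simp only [mk_prod, Cardinal.mk_Iio_ordinal, card_ord, Cardinal.lift_id]
  exact mul_le_of_le (by simpa using hlam.trans hle) (Cardinal.lift_le.2 hle) le_rfl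

theorem mem_of_isClosed_of_basicMu {F : Set (Space lam mu kap M C)} (hF : IsClosed F)
    (hmu : ℵ₀ ≤ mu) {x : Space lam mu kap M C} (hx : x.val.1.cof = mu)
    (h : ∀ η < mu.ord, ∃ y ∈ F, y.val ∈ basicMu mu kap M C x.val η) : x ∈ F := by
  by_contra hxF
  -- By definition of the topology, openness of `Fᶜ` is membership in this infimum. The basic sets
  -- decrease with `η`, so the family is directed and a single basic set already lies in `Fᶜ`.
  have hmem : Fᶜ ∈ ⨅ B ∈ base mu kap M C x.val,
      Filter.principal {y : Space lam mu kap M C | y.val ∈ B} := hF.isOpen_compl x hxF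
  have hanti : Antitone (basicMu mu kap M C x.val) := fun a b hab ↦
    union_subset_union_right _ (biUnion_subset_biUnion_left fun ξ hξ ↦
      ⟨hξ.1, fun hlt ↦ hξ.2 (lt_of_lt_of_le hlt hab)⟩)
  have hbase : ∀ B ∈ base mu kap M C x.val, ∃ η < mu.ord, B = basicMu mu kap M C x.val η := by
    rintro B (⟨-, hB⟩ | ⟨hlt, -⟩ | ⟨hlt, -⟩)
    exacts [hB, (hlt.ne hx).elim, (hlt.ne' hx).elim]
  have hbase' : ∀ η < mu.ord, basicMu mu kap M C x.val η ∈ base mu kap M C x.val :=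
    fun η hη ↦ .inl ⟨hx, η, hη, rfl⟩
  rw [Filter.mem_biInf_of_directed] at hmem
  · obtain ⟨B, hB, hsub⟩ := hmem
    obtain ⟨η, hη, rfl⟩ := hbase B hB
    obtain ⟨y, hyF, hy⟩ := h η hη
    exact Filter.mem_principal.1 hsub hy hyF
  · intro B hB B' hB'
    obtain ⟨η, hη, rfl⟩ := hbase B hB
    obtain ⟨η', hη', rfl⟩ := hbase B' hB'
    refine ⟨_, hbase' (max η η') (max_lt hη hη'), ?_, ?_⟩
    · exact Filter.principal_mono.2 fun y hy ↦ hanti (le_max_left _ _) hy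
    · exact Filter.principal_mono.2 fun y hy ↦ hanti (le_max_right _ _) hy
  · exact ⟨_, hbase' 0 (isSuccLimit_ord hmu).bot_lt⟩

/-- If `C α` consists of limit points of `π(F)`, then `F` contains the whole column `X_α`. -/
theorem mem_of_forall_limitPoint {F : Set (Space lam mu kap M C)} (hF : IsClosed F)
    (hmu : ℵ₀ ≤ mu) {x : Space lam mu kap M C} (hx : x.val.1.cof = mu)
    (hM : IsLargeSubset mu (M x.val.2)) (e : Iio mu.ord ≃o C x.val.1)
    (hlim : ∀ δ ∈ C x.val.1, ∀ β < δ, ∃ γ, (slice F γ).Nonempty ∧ β < γ ∧ γ < δ) : x ∈ F := by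
  refine mem_of_isClosed_of_basicMu hF hmu hx fun η hη ↦ ?_
  obtain ⟨ξ, hξ, hηξ⟩ := hM.exists_ge hη
  have hξmu : ξ < mu.ord := hM.1 hξ
  have hξ' : ξ + 1 < mu.ord := (isSuccLimit_ord hmu).add_one_lt hξmu
  have ha : enumOrd (C x.val.1) ξ = e ⟨ξ, hξmu⟩ := enumOrd_eq_orderIso e ⟨ξ, hξmu⟩
  have hb : enumOrd (C x.val.1) (ξ + 1) = e ⟨ξ + 1, hξ'⟩ := enumOrd_eq_orderIso e ⟨ξ + 1, hξ'⟩
  have hlt : (e ⟨ξ, hξmu⟩).1 < e ⟨ξ + 1, hξ'⟩ := e.strictMono (lt_add_one ξ)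
  -- A level strictly between consecutive elements of `C α` lies in either form of the interval.
  obtain ⟨γ, ⟨y, hyF, hy⟩, h1, h2⟩ := hlim _ (e ⟨ξ + 1, hξ'⟩).2 _ hlt
  refine ⟨y, hyF, .inr (mem_iUnion₂.2 ⟨ξ, ⟨hξ, not_lt.2 hηξ⟩, mem_iUnion₂.2 ⟨γ, ?_, hy⟩⟩)⟩
  rw [interval, ha, hb]
  split_ifs
  exacts [⟨h1.le, h2.le⟩, ⟨h1, h2.le⟩]

theorem isHigh_univ (hlam : lam.IsRegular) (hmu : ℵ₀ ≤ mu) (hlt : mu < lam) (hle : lam ≤ kap)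
    (hM : ∀ φ < kap.ord, IsLargeSubset mu (M φ)) (hC : IsClubGuessing lam mu C) :
    IsHigh (univ : Set (Space lam mu kap M C)) := by
  intro F _ hF hFu
  set P := {α | α < lam.ord ∧ (slice F α).Nonempty}
  set T := {α : Ordinal.{u} | α < lam.ord ∧ #(slice F α) = #F}
  have hTu : ∀ β < lam.ord, ∃ α ∈ T, β ≤ α := by
    intro β hβ
    obtain ⟨α, hα, hsub⟩ := hC.2 _ (isClubIn_limitPoints hlam (hmu.trans_lt hlt)
      (P := P) (fun x hx ↦ hx.1) (fun β hβ ↦ by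
        obtain ⟨α, hα, hβα, hne⟩ := hFu β hβ
        exact ⟨α, ⟨hα, hne⟩, hβα⟩) hβ)
    obtain ⟨hclub, ⟨e⟩⟩ := hC.1 α hα
    -- The guessed club has only limit points `≥ β`, so its first element already puts `α` above
    -- `β`.
    have hβα : β ≤ α := by
      have hmem := (e ⟨0, (isSuccLimit_ord hmu).bot_lt⟩).2
      exact (hsub hmem).2.1.trans (hclub.1 hmem).le
    have hcol : ∀ φ : Iio kap.ord, (α, φ.1) ∈ column mu kap α := fun φ ↦
      ⟨rfl, .inl ⟨hα.2, φ.2⟩⟩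
    have hin : ∀ φ : Iio kap.ord,
        (⟨(α, φ.1), mem_biUnion hα.1 (hcol φ)⟩ : Space lam mu kap M C) ∈ F := fun φ ↦
      mem_of_forall_limitPoint hF hmu hα.2 (hM _ φ.2) e fun δ hδ β hβ ↦ by
        obtain ⟨γ, hγ, h⟩ := (hsub hδ).2.2 β hβ
        exact ⟨γ, hγ.2, h⟩
    refine ⟨α, ⟨hα.1, le_antisymm (mk_le_mk_of_subset fun x hx ↦ hx.1) ?_⟩, hβα⟩
    -- Sandwich: `|F| ≤ |X| ≤ kap ≤ |F_α|`.
    refine ((mk_set_le F).trans (mk_space_le hlam.aleph0_le hle)).trans ?_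
    have hkap : #(Iio kap.ord) = Cardinal.lift.{u + 1} kap := by simp
    refine hkap.ge.trans (mk_le_of_injective (f := fun φ ↦ ⟨_, hin φ, hcol φ⟩) fun φ ψ h ↦ Subtype.ext ?_)
    exact congrArg (fun p ↦ p.1.val.2) h
  have := lift_cof_le_mk_of_unbounded (G := T) (fun α hα ↦ hα.1) hTu
  rw [hlam.cof_ord] at this
  exact (Cardinal.lift_le.2 hlt.le).trans this

end ClubSpace

theorem mainTheorem8 :
    ((ℵ_ 2 : Cardinal.{u}) ≤ 2 ^ (ℵ₀ : Cardinal.{u}) →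
      (∃ 𝓜 : Set (Set Ordinal.{u}), IsMADFamily ℵ₀ 𝓜 ∧
        #𝓜 = Cardinal.lift.{u + 1} (2 ^ (ℵ₀ : Cardinal.{u}))) ∧
      (∃ C : Ordinal.{u} → Set Ordinal.{u}, IsClubGuessing (ℵ_ 2) ℵ₀ C) ∧
      ∀ (𝓜 : Set (Set Ordinal.{u})) (M C : Ordinal.{u} → Set Ordinal.{u}),
        IsMADFamily ℵ₀ 𝓜 → BijOn M (Iio (2 ^ (ℵ₀ : Cardinal.{u}) : Cardinal.{u}).ord) 𝓜 →
        IsClubGuessing (ℵ_ 2) ℵ₀ C →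
        ClubSpace.IsHigh
          (univ : Set (ClubSpace.Space (ℵ_ 2) ℵ₀ (2 ^ (ℵ₀ : Cardinal.{u})) M C))) ∧
    (2 ^ (ℵ₀ : Cardinal.{u}) = ℵ_ 1 → (ℵ_ 3 : Cardinal.{u}) ≤ 2 ^ (ℵ_ 1 : Cardinal.{u}) →
      (∃ 𝓜 : Set (Set Ordinal.{u}), IsMADFamily (ℵ_ 1) 𝓜 ∧
        #𝓜 = Cardinal.lift.{u + 1} (2 ^ (ℵ_ 1 : Cardinal.{u}))) ∧
      (∃ C : Ordinal.{u} → Set Ordinal.{u}, IsClubGuessing (ℵ_ 3) (ℵ_ 1) C) ∧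
      ∀ (𝓜 : Set (Set Ordinal.{u})) (M C : Ordinal.{u} → Set Ordinal.{u}),
        IsMADFamily (ℵ_ 1) 𝓜 → BijOn M (Iio (2 ^ (ℵ_ 1 : Cardinal.{u}) : Cardinal.{u}).ord) 𝓜 →
        IsClubGuessing (ℵ_ 3) (ℵ_ 1) C →
        ClubSpace.IsHigh
          (univ : Set (ClubSpace.Space (ℵ_ 3) (ℵ_ 1) (2 ^ (ℵ_ 1 : Cardinal.{u})) M C))) := by
  have h2 : (ℵ_ 2 : Cardinal.{u}) = Order.succ (ℵ_ 1) := by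
    rw [succ_aleph, one_add_one_eq_two]
  have h3 : (ℵ_ 3 : Cardinal.{u}) = Order.succ (ℵ_ 2) := by
    rw [succ_aleph, two_add_one_eq_three]
  have hreg2 : (ℵ_ 2 : Cardinal.{u}).IsRegular := h2 ▸ isRegular_succ (aleph0_le_aleph 1)
  have hreg3 : (ℵ_ 3 : Cardinal.{u}).IsRegular := h3 ▸ isRegular_succ (aleph0_le_aleph 2)
  have hlt2 : Order.succ (ℵ₀ : Cardinal.{u}) < ℵ_ 2 := by
    rw [succ_aleph0, h2]
    exact Order.lt_succ _
  have hlt3 : Order.succ (ℵ_ 1 : Cardinal.{u}) < ℵ_ 3 := by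
    rw [← h2, h3]
    exact Order.lt_succ _
  refine ⟨fun hc ↦ ⟨exists_isMADFamily le_rfl fun c hc ↦ ?_,
    exists_isClubGuessing hreg2 isRegular_aleph0 hlt2, fun 𝓜 M C h𝓜 hM hC ↦ ?_⟩,
    fun hCH hc ↦ ⟨exists_isMADFamily (aleph0_le_aleph 1) fun c hc ↦ ?_,
    exists_isClubGuessing hreg3 isRegular_aleph_one hlt3, fun 𝓜 M C h𝓜 hM hC ↦ ?_⟩⟩
  · exact (power_lt_aleph0 (natCast_lt_aleph0 (n := 2)) hc).le
  · exact ClubSpace.isHigh_univ hreg2 le_rfl ((Order.lt_succ _).trans hlt2) hc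
      (fun φ hφ ↦ h𝓜.large _ (hM.mapsTo hφ)) hC
  -- Here `c` is countable, so `2 ^ c ≤ ℵ₁` by CH; this is the only use of CH.
  · rw [← succ_aleph0, Order.lt_succ_iff] at hc
    exact (power_le_power_left two_ne_zero hc).trans hCH.le
  · exact ClubSpace.isHigh_univ hreg3 (aleph0_le_aleph 1) ((Order.lt_succ _).trans hlt3) hc
      (fun φ hφ ↦ h𝓜.large _ (hM.mapsTo hφ)) hC
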